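/- Let $a>0$, $c>0$, $\gamma>0$. For $N\ge 2$ let $B$ be the $N\times N$ symmetric tridiagonal matrix with diagonal entries $a+2c$ and off-diagonal entries $-c$, let $\Gamma=\operatorname{diag}(\gamma,0,\dots,0,\gamma)\in\mathbb{R}^{N\times N}$, and let $$M=\begin{bmatrix}\Gamma & -I\\ B & 0\end{bmatrix}\in\mathbb{R}^{2N\times 2N}$$ be the drift matrix of the purely harmonic homogeneous chain of $N$ oscillators with pinning coefficient $a$, interaction coefficient $c$ and friction $\gamma$ at both ends. Its spectral gap is $\rho_N=\inf\{\operatorname{Re}\mu:\mu\in\sigma(M)\}$. Then $\rho_N\gtrsim N^{-3}$: there is a constant $\kappa>0$ depending only on $a,c,\gamma$ with $$\rho_N\ge \kappa N^{-3}\qquad\text{for all } N\ge 2 .$$ Moreover, let $T_L,T_R>0$ and $\Pi_N=\operatorname{diag}(2T_L,1,\dots,1,2T_R,1,\dots,1)\in\mathbb{R}^{2N\times 2N}$, where $2T_L$ and $2T_R$ are the first and the $N$-th entry. Then for every $N\ge2$ the equation $b_NM+M^Tb_N=\Pi_N$ has a unique solution $b_N\in\mathbb{R}^{2N\times2N}$,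 it is symmetric and positive definite, and in the spectral norm $$\rho_N\ \ge\ \frac{\min\{1,2T_L,2T_R\}}{2\|b_N\|};$$ in particular $\rho_N\ge \frac1{2\|b_N\|}$ if $2T_L\ge1$ and $2T_R\ge1$. Finally $\|b_N\|=O(N^3)$: there is a constant $C$, depending only on $a,c,\gamma,T_L,T_R$, such that $\|b_N\|\le CN^3$ for all $N\ge2$. -/

import Mathlib

namespace HarmonicChain

/-- The friction matrix `Γ = diag(γ, 0, …, 0, γ)` (`N ≥ 2` oscillators). -/
def friction (N : ℕ) (γ : ℝ) : Matrix (Fin N) (Fin N) ℝ :=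
  Matrix.diagonal fun i => if (i : ℕ) = 0 ∨ (i : ℕ) + 1 = N then γ else 0

/-- The symmetric tridiagonal matrix `B` with `a + 2c` on the diagonal and `-c` next to it:
the Hessian of `∑ a qᵢ²/2 + ∑ c (qᵢ₊₁ - qᵢ)²/2 + c q₁²/2 + c q_N²/2`. -/
def stiffness (N : ℕ) (a c : ℝ) : Matrix (Fin N) (Fin N) ℝ :=
  Matrix.of fun i j =>
    if i = j then a + 2 * c
    else if (i : ℕ) + 1 = (j : ℕ) ∨ (j : ℕ) + 1 = (i : ℕ) then -c else 0

/-- The drift matrix `M = [[Γ, -I], [B, 0]]` of the chain in the variables `z = (p, q)`. -/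
def drift (N : ℕ) (a c γ : ℝ) : Matrix (Fin N ⊕ Fin N) (Fin N ⊕ Fin N) ℝ :=
  Matrix.fromBlocks (friction N γ) (-1) (stiffness N a c) 0

/-- `Π_N = diag(2 T_L, 1, …, 1, 2 T_R, 1, …, 1)`, the entries `2 T_L` and `2 T_R` being those of
`p₁` and `p_N`. -/
def noise (N : ℕ) (TL TR : ℝ) : Matrix (Fin N ⊕ Fin N) (Fin N ⊕ Fin N) ℝ :=
  Matrix.diagonal (Sum.elim
    (fun i : Fin N => if (i : ℕ) = 0 then 2 * TL else if (i : ℕ) + 1 = N then 2 * TR else 1)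
    (fun _ => 1))

/-- `b` solves the Lyapunov equation `b M + Mᵀ b = Π_N`. -/
def SolvesLyapunov (N : ℕ) (a c γ TL TR : ℝ) (b : Matrix (Fin N ⊕ Fin N) (Fin N ⊕ Fin N) ℝ) :
    Prop :=
  b * drift N a c γ + (drift N a c γ).transpose * b = noise N TL TR

/-- The spectral norm: the operator norm for the Euclidean norm. -/
noncomputable def matrixNorm {n : Type*} [Fintype n] [DecidableEq n] (b : Matrix n n ℝ) : ℝ :=
  ‖Matrix.toEuclideanCLM (n := n) (𝕜 := ℝ) b‖

/-- The spectral gap `inf {Re μ : μ ∈ σ(M)}`, with `σ(M)` the set of complex eigenvalues. -/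
noncomputable def spectralGap (N : ℕ) (a c γ : ℝ) : ℝ :=
  sInf (Complex.re '' spectrum ℂ ((drift N a c γ).map (algebraMap ℝ ℂ)))

end HarmonicChain

/-!
Along the flow `p' = -(Γ p - q)`, `q' = -B p` of `z' = -M z`, put `r = p' = q - Γ p`, so that
`r' = -B p - Γ r`. The proof constructs a quadratic Lyapunov function of size `O(N³)` which
dissipates at least `|z|²` (`exists_lyapunov_bounds`), and compares `b` with it.

* The energies `|p|² + q ⬝ B⁻¹ q` and `|r|² + p ⬝ B p` decay at the rates `2 p ⬝ Γ p` and
  `2 r ⬝ Γ r`, so they control both ends of the chain.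
* For the skew-symmetric multiplier `K`, a centred difference weighted by the signed distance to the
  middle, `r ⬝ K p` decays at the rate `B p ⬝ K p + Γ r ⬝ K p`. The first term is `c / 2` times the
  sum of the squares of `p_{j+1} - p_{j-1}`, up to `O(N) p ⬝ Γ p` (`stiffness_dotProduct_multiplier`).
  The second lives at the ends, where `K p` is a multiple of the off-diagonal part of `B p`
  (`friction_multiplier_eq`); since `B p = -(r' + Γ r)`, it is a time derivative up to
  `O(N) (p ⬝ Γ p + r ⬝ Γ r)`.
* A discrete Poincaré inequality bounds `|p|²` by `N²` times the centred differences and `N p₁²`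
  (`dotProduct_self_le_centredEnergy`), and the equipartition term `r ⬝ p` passes from `p` to `r`.
  The multiplier is `O(N)`, so weighting it by `N²` gives the order `N³`.

The comparison principle `IsStrictLyapunov.nonneg_of_dissipates` is algebraic and avoids the matrix
exponential: given one strict Lyapunov function, every quadratic form that does not increase along
the flow is nonnegative. It yields unique solvability of the Lyapunov equation, positivity of `b`,
and the bound of `b` by the Lyapunov function. Finally, evaluating the Lyapunov equation at an
eigenvector gives the bound of the spectral gap by `‖b‖` (`le_re_of_mem_spectrum`).
-/

open Matrix

namespace HarmonicChain

/-! ### Lyapunov functions and the Lyapunov equation -/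

section Lyapunov

variable {n : Type*} [Fintype n]

/-- The quadratic form of `W` is a strict Lyapunov function for the flow `z' = -M z`: it is positive
definite, and strictly decreasing along nonzero solutions. `W` need not be symmetric. -/
structure IsStrictLyapunov (W M : Matrix n n ℝ) : Prop where
  pos : ∀ z : n → ℝ, z ≠ 0 → 0 < z ⬝ᵥ W *ᵥ z
  dissipates : ∀ z : n → ℝ, z ≠ 0 → 0 < z ⬝ᵥ W *ᵥ (M *ᵥ z) + (M *ᵥ z) ⬝ᵥ W *ᵥ z

/-- Comparison principle: a quadratic form that does not increase along a flow which admits a strict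
Lyapunov function is nonnegative. At a minimiser `z` of the quotient of the two forms, a suitable
combination of them is nonnegative and vanishes, so its derivative in the direction `M z` is zero,
which the dissipation rates forbid if the minimum is negative. -/
theorem IsStrictLyapunov.nonneg_of_dissipates {W M : Matrix n n ℝ} (h : IsStrictLyapunov W M)
    {A : Matrix n n ℝ} (hA : ∀ z : n → ℝ, 0 ≤ z ⬝ᵥ A *ᵥ (M *ᵥ z) + (M *ᵥ z) ⬝ᵥ A *ᵥ z)
    (z : n → ℝ) : 0 ≤ z ⬝ᵥ A *ᵥ z := by
  by_contra! hz
  have hz0 : z ≠ 0 := by rintro rfl; simp at hz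
  have hcont : ∀ B : Matrix n n ℝ, Continuous fun x : n → ℝ => x ⬝ᵥ B *ᵥ x := fun B => by
    fun_prop
  have hsph : ∀ x : n → ℝ, x ∈ Metric.sphere (0 : n → ℝ) 1 → x ≠ 0 := by
    rintro x hx rfl; simp at hx
  have hscale : ∀ (B : Matrix n n ℝ) (t : ℝ) (x : n → ℝ),
      (t • x) ⬝ᵥ B *ᵥ (t • x) = t ^ 2 * (x ⬝ᵥ B *ᵥ x) := by
    intro B t x
    simp only [mulVec_smul, dotProduct_smul, smul_dotProduct, smul_eq_mul]; ring
  have hmem : ∀ x : n → ℝ, x ≠ 0 → ‖x‖⁻¹ • x ∈ Metric.sphere (0 : n → ℝ) 1 := by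
    intro x hx
    simp [norm_smul, norm_ne_zero_iff.mpr hx]
  obtain ⟨y, hy, hmin⟩ := (isCompact_sphere (0 : n → ℝ) 1).exists_isMinOn ⟨_, hmem z hz0⟩
    (f := fun x : n → ℝ => (x ⬝ᵥ A *ᵥ x) / (x ⬝ᵥ W *ᵥ x))
    ((hcont A).continuousOn.div (hcont W).continuousOn fun x hx => (h.pos x (hsph x hx)).ne')
  have hy0 := hsph y hy
  set m := (y ⬝ᵥ A *ᵥ y) / (y ⬝ᵥ W *ᵥ y) with hm
  have hle : ∀ x : n → ℝ, m * (x ⬝ᵥ W *ᵥ x) ≤ x ⬝ᵥ A *ᵥ x := by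
    intro x
    rcases eq_or_ne x 0 with rfl | hx
    · simp
    have h1 := isMinOn_iff.mp hmin _ (hmem x hx)
    simp only [hscale] at h1
    rw [mul_div_mul_left _ _ (pow_ne_zero 2 (inv_ne_zero (norm_ne_zero_iff.mpr hx))),
      le_div_iff₀ (h.pos x hx)] at h1
    exact h1
  have hmneg : m < 0 := by
    by_contra! hm0
    have := hle z
    have := mul_nonneg hm0 (h.pos z hz0).le
    linarith
  have hyA : y ⬝ᵥ A *ᵥ y = m * (y ⬝ᵥ W *ᵥ y) := by
    rw [hm, div_mul_cancel₀ _ (h.pos y hy0).ne']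
  have hexp : ∀ (B : Matrix n n ℝ) (t : ℝ) (w : n → ℝ), (y - t • w) ⬝ᵥ B *ᵥ (y - t • w) =
      y ⬝ᵥ B *ᵥ y - t * (y ⬝ᵥ B *ᵥ w + w ⬝ᵥ B *ᵥ y) + t ^ 2 * (w ⬝ᵥ B *ᵥ w) := by
    intro B t w
    simp only [mulVec_sub, mulVec_smul, dotProduct_sub, sub_dotProduct, dotProduct_smul,
      smul_dotProduct, smul_eq_mul]
    ring
  set w := M *ᵥ y
  set l := (y ⬝ᵥ A *ᵥ w + w ⬝ᵥ A *ᵥ y) - m * (y ⬝ᵥ W *ᵥ w + w ⬝ᵥ W *ᵥ y) with hl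
  set k := w ⬝ᵥ A *ᵥ w - m * (w ⬝ᵥ W *ᵥ w) with hk
  have hl0 : 0 < l := by
    have h1 := hA y
    have h2 := mul_neg_of_neg_of_pos hmneg (h.dissipates y hy0)
    simp only [hl]
    linarith
  have hk0 : 0 ≤ k := by have := hle w; simp only [hk]; linarith
  have hq : ∀ t : ℝ, 0 ≤ -(t * l) + t ^ 2 * k := by
    intro t
    have h1 := hle (y - t • w)
    rw [hexp, hexp, hyA] at h1
    simp only [hl, hk]
    linarith
  have h1 := hq (l / (k + 1))
  have h2 : -(l / (k + 1) * l) + (l / (k + 1)) ^ 2 * k = -(l / (k + 1)) ^ 2 := by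
    field_simp; ring
  rw [h2] at h1
  have : 0 < (l / (k + 1)) ^ 2 := by positivity
  linarith

/-- Bilinear form of a block matrix. -/
theorem sumElim_dotProduct_fromBlocks_mulVec {m : Type*} [Fintype m] (A : Matrix n n ℝ)
    (B : Matrix n m ℝ) (C : Matrix m n ℝ) (D : Matrix m m ℝ) (x x' : n → ℝ) (y y' : m → ℝ) :
    Sum.elim x y ⬝ᵥ fromBlocks A B C D *ᵥ Sum.elim x' y' =
      x ⬝ᵥ A *ᵥ x' + x ⬝ᵥ B *ᵥ y' + y ⬝ᵥ C *ᵥ x' + y ⬝ᵥ D *ᵥ y' := by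
  simp only [fromBlocks_mulVec, sumElim_dotProduct_sumElim, dotProduct_add, Sum.elim_comp_inl,
    Sum.elim_comp_inr]
  ring

theorem dotProduct_lyapunov_mulVec (b M : Matrix n n ℝ) (x y : n → ℝ) :
    x ⬝ᵥ (b * M + Mᵀ * b) *ᵥ y = x ⬝ᵥ b *ᵥ (M *ᵥ y) + (M *ᵥ x) ⬝ᵥ b *ᵥ y := by
  rw [add_mulVec, dotProduct_add, mulVec_mulVec, ← mulVec_mulVec y Mᵀ b,
    dotProduct_mulVec x Mᵀ, vecMul_transpose]

theorem IsStrictLyapunov.fromBlocks_diag {W M : Matrix n n ℝ} (h : IsStrictLyapunov W M) :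
    IsStrictLyapunov (fromBlocks W 0 0 W) (fromBlocks M 0 0 M) := by
  have key : ∀ f : (n → ℝ) → ℝ, f 0 = 0 → (∀ z, z ≠ 0 → 0 < f z) →
      ∀ x y : n → ℝ, Sum.elim x y ≠ 0 → 0 < f x + f y := by
    intro f f0 hf x y hxy
    have hn : ∀ z, 0 ≤ f z := fun z => by
      rcases eq_or_ne z 0 with rfl | hz
      · exact f0.ge
      · exact (hf z hz).le
    rcases eq_or_ne x 0 with rfl | hx
    · rcases eq_or_ne y 0 with rfl | hy
      · exact absurd (by ext (i | i) <;> rfl) hxy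
      · exact add_pos_of_nonneg_of_pos (hn _) (hf y hy)
    · exact add_pos_of_pos_of_nonneg (hf x hx) (hn _)
  constructor
  · intro z hz
    rw [← Sum.elim_comp_inl_inr z] at hz ⊢
    have := key (fun x => x ⬝ᵥ W *ᵥ x) (by simp) h.pos _ _ hz
    rw [sumElim_dotProduct_fromBlocks_mulVec]
    simpa using this
  · intro z hz
    rw [← Sum.elim_comp_inl_inr z] at hz ⊢
    have := key (fun x => x ⬝ᵥ W *ᵥ (M *ᵥ x) + (M *ᵥ x) ⬝ᵥ W *ᵥ x) (by simp) h.dissipates _ _ hz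
    rw [fromBlocks_mulVec M]
    simp only [sumElim_dotProduct_fromBlocks_mulVec, Sum.elim_comp_inl, Sum.elim_comp_inr,
      zero_mulVec, dotProduct_zero, add_zero, zero_add]
    linarith

/-- The Lyapunov operator has trivial kernel. For `b` in the kernel, the form `(x, y) ↦ x ⬝ b y` is
constant along two copies of the flow, so the comparison principle makes it nonnegative at every
`(x, y)`, hence zero. -/
theorem IsStrictLyapunov.eq_zero_of_lyapunov_eq_zero {W M : Matrix n n ℝ}
    (h : IsStrictLyapunov W M) {b : Matrix n n ℝ} (hb : b * M + Mᵀ * b = 0) : b = 0 := by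
  classical
  have hxy : ∀ x y : n → ℝ, 0 ≤ x ⬝ᵥ b *ᵥ y := by
    intro x y
    have := h.fromBlocks_diag.nonneg_of_dissipates (A := fromBlocks 0 b 0 0) (by
      intro z
      rw [← Sum.elim_comp_inl_inr z, fromBlocks_mulVec M]
      simp only [sumElim_dotProduct_fromBlocks_mulVec, Sum.elim_comp_inl, Sum.elim_comp_inr,
        zero_mulVec, dotProduct_zero, add_zero, zero_add]
      rw [← dotProduct_lyapunov_mulVec, hb]
      simp) (Sum.elim x y)
    simpa [sumElim_dotProduct_fromBlocks_mulVec] using this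
  ext i j
  have h1 := hxy (Pi.single i 1) (Pi.single j 1)
  have h2 := hxy (-Pi.single i 1) (Pi.single j 1)
  simp at h1 h2
  simpa using le_antisymm h2 h1

theorem IsStrictLyapunov.existsUnique {W M : Matrix n n ℝ} (h : IsStrictLyapunov W M)
    (Q : Matrix n n ℝ) : ∃! b : Matrix n n ℝ, b * M + Mᵀ * b = Q := by
  let f : Matrix n n ℝ →ₗ[ℝ] Matrix n n ℝ :=
    LinearMap.mulRight ℝ M + LinearMap.mulLeft ℝ Mᵀ
  have hf : ∀ b, f b = b * M + Mᵀ * b := fun b => rfl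
  have hinj : Function.Injective f := by
    rw [injective_iff_map_eq_zero]
    exact fun b hb => h.eq_zero_of_lyapunov_eq_zero hb
  obtain ⟨b, hb⟩ := LinearMap.surjective_of_injective hinj Q
  exact ⟨b, hb, fun b' hb' => hinj (by rw [hf, hb', hb])⟩

theorem IsStrictLyapunov.posDef {W M : Matrix n n ℝ} (h : IsStrictLyapunov W M)
    {b Q : Matrix n n ℝ} (hQ : Q.PosDef) (hb : b * M + Mᵀ * b = Q) : b.PosDef := by
  have hQpos : ∀ z : n → ℝ, z ≠ 0 → 0 < z ⬝ᵥ Q *ᵥ z := fun z hz => by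
    simpa using hQ.dotProduct_mulVec_pos hz
  have hQs : Qᵀ = Q := by simpa using hQ.isHermitian.eq
  have hsymm : bᵀ = b := (h.existsUnique Q).unique
    (by rw [← hQs, ← hb, transpose_add, transpose_mul, transpose_mul, transpose_transpose,
      add_comm]) hb
  have hnn := h.nonneg_of_dissipates (A := b) (by
    intro z
    rw [← dotProduct_lyapunov_mulVec, hb]
    rcases eq_or_ne z 0 with rfl | hz
    · simp
    · exact (hQpos z hz).le)
  have hpsd : b.PosSemidef := .of_dotProduct_mulVec_nonneg (by simpa [IsHermitian] using hsymm)
    (by simpa using hnn)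
  refine .of_dotProduct_mulVec_pos hpsd.isHermitian fun z hz => ?_
  refine (hpsd.dotProduct_mulVec_nonneg z).lt_of_ne' fun h0 => ?_
  have hbz := (hpsd.dotProduct_mulVec_zero_iff z).mp h0
  have h1 := hQpos z hz
  rw [← hb, dotProduct_lyapunov_mulVec, hbz, dotProduct_zero, add_zero, dotProduct_mulVec,
    ← mulVec_transpose, hsymm, hbz, zero_dotProduct] at h1
  exact lt_irrefl _ h1

/-- The quadratic form of a solution of the Lyapunov equation is bounded by that of any matrix which
dissipates faster. -/
theorem IsStrictLyapunov.form_le {W M : Matrix n n ℝ} (h : IsStrictLyapunov W M)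
    {b Q : Matrix n n ℝ} (hb : b * M + Mᵀ * b = Q) {t : ℝ}
    (hQ : ∀ z : n → ℝ, z ⬝ᵥ Q *ᵥ z ≤ t * (z ⬝ᵥ W *ᵥ (M *ᵥ z) + (M *ᵥ z) ⬝ᵥ W *ᵥ z))
    (z : n → ℝ) : z ⬝ᵥ b *ᵥ z ≤ t * (z ⬝ᵥ W *ᵥ z) := by
  have := h.nonneg_of_dissipates (A := t • W - b) (by
    intro x
    have h1 := hQ x
    rw [← hb, dotProduct_lyapunov_mulVec] at h1
    simp only [sub_mulVec, smul_mulVec, dotProduct_sub, dotProduct_smul, smul_eq_mul]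
    linarith) z
  simp only [sub_mulVec, smul_mulVec, dotProduct_sub, dotProduct_smul, smul_eq_mul] at this
  linarith

end Lyapunov

/-! ### The spectral norm and the spectrum -/

section Spectral

variable {n : Type*} [Fintype n]

theorem dotProduct_self_eq_norm_sq (z : n → ℝ) : z ⬝ᵥ z = ‖WithLp.toLp 2 z‖ ^ 2 := by
  rw [EuclideanSpace.real_norm_sq_eq]
  simp [dotProduct, sq]

variable [DecidableEq n]

theorem dotProduct_mulVec_le_matrixNorm (b : Matrix n n ℝ) (z : n → ℝ) :
    z ⬝ᵥ b *ᵥ z ≤ matrixNorm b * (z ⬝ᵥ z) := by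
  have h1 : z ⬝ᵥ b *ᵥ z =
      inner ℝ (toEuclideanCLM (n := n) (𝕜 := ℝ) b (WithLp.toLp 2 z)) (WithLp.toLp 2 z) := by
    simp [EuclideanSpace.inner_eq_star_dotProduct]
  rw [h1, dotProduct_self_eq_norm_sq]
  refine (real_inner_le_norm _ _).trans ?_
  have := (toEuclideanCLM (n := n) (𝕜 := ℝ) b).le_opNorm (WithLp.toLp 2 z)
  rw [sq, ← mul_assoc]
  exact mul_le_mul_of_nonneg_right this (norm_nonneg _)

theorem matrixNorm_le_of_posSemidef {b : Matrix n n ℝ} (hb : b.PosSemidef) {t : ℝ} (ht : 0 ≤ t)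
    (h : ∀ z : n → ℝ, z ⬝ᵥ b *ᵥ z ≤ t * (z ⬝ᵥ z)) : matrixNorm b ≤ t := by
  have hsymm : bᵀ = b := by simpa using hb.isHermitian.eq
  refine ContinuousLinearMap.opNorm_le_bound _ ht fun x => ?_
  set z : n → ℝ := WithLp.ofLp x with hz
  set y := b *ᵥ z with hy
  have hx : z ⬝ᵥ z = ‖x‖ ^ 2 := dotProduct_self_eq_norm_sq z
  have hbx : y ⬝ᵥ y = ‖toEuclideanCLM (n := n) (𝕜 := ℝ) b x‖ ^ 2 := by
    rw [dotProduct_self_eq_norm_sq]; rfl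
  -- `0 ≤ (t z - y) ⬝ b (t z - y)` bounds `|b z|²` by `t² |z|²`
  have h0 : 0 ≤ (t • z - y) ⬝ᵥ b *ᵥ (t • z - y) := by
    simpa using hb.dotProduct_mulVec_nonneg (t • z - y)
  have hsw : z ⬝ᵥ b *ᵥ y = y ⬝ᵥ y := by
    rw [dotProduct_mulVec, ← mulVec_transpose, hsymm]
  simp only [mulVec_sub, mulVec_smul, dotProduct_sub, sub_dotProduct, dotProduct_smul,
    smul_dotProduct, smul_eq_mul, hsw] at h0
  rw [← hy] at h0
  have h1 := h y
  have h2 := h z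
  rw [← hy] at h2
  rcases ht.eq_or_lt with rfl | ht'
  · have h3 : (0:ℝ) ≤ (z - y) ⬝ᵥ b *ᵥ (z - y) := by
      simpa using hb.dotProduct_mulVec_nonneg (z - y)
    simp only [mulVec_sub, dotProduct_sub, sub_dotProduct, hsw] at h3
    rw [← hy] at h3
    have h4 : y ⬝ᵥ y ≤ 0 := by linarith
    rw [hbx] at h4
    have := pow_eq_zero_iff (two_ne_zero) |>.mp (le_antisymm h4 (sq_nonneg _))
    rw [this, zero_mul]
  · have h3 : t * (y ⬝ᵥ y) ≤ t * (t ^ 2 * (z ⬝ᵥ z)) := by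
      have := mul_le_mul_of_nonneg_left h2 (sq_nonneg t)
      nlinarith
    have h4 := le_of_mul_le_mul_left h3 ht'
    rw [hx, hbx, ← mul_pow] at h4
    exact (sq_le_sq₀ (norm_nonneg _) (by positivity)).mp h4

/-- Real parts of the eigenvalues of `M` through the Lyapunov equation: for an eigenvector
`x + i y`, the form of `b M + Mᵀ b` at `x` plus that at `y` is `2 Re μ` times the form of `b`. -/
theorem le_re_of_mem_spectrum {b M : Matrix n n ℝ} (hb : b.PosSemidef) {m : ℝ}
    (h : ∀ z : n → ℝ, m * (z ⬝ᵥ z) ≤ z ⬝ᵥ (b * M + Mᵀ * b) *ᵥ z) (hm : 0 < m)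
    {μ : ℂ} (hμ : μ ∈ spectrum ℂ (M.map (algebraMap ℝ ℂ))) :
    m / (2 * matrixNorm b) ≤ μ.re := by
  have hsymm : bᵀ = b := by simpa using hb.isHermitian.eq
  rw [← spectrum_toLin', ← Module.End.hasEigenvalue_iff_mem_spectrum] at hμ
  obtain ⟨v, hv⟩ := hμ.exists_hasEigenvector
  have hv0 := hv.2
  have hMv : M.map (algebraMap ℝ ℂ) *ᵥ v = μ • v := by simpa using hv.apply_eq_smul
  set x : n → ℝ := fun i => (v i).re
  set y : n → ℝ := fun i => (v i).im
  have hx : M *ᵥ x = μ.re • x - μ.im • y := by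
    ext i
    have := congrArg Complex.re (congrFun hMv i)
    simpa [mulVec, dotProduct, x, y] using this
  have hy : M *ᵥ y = μ.re • y + μ.im • x := by
    ext i
    have := congrArg Complex.im (congrFun hMv i)
    simpa [mulVec, dotProduct, x, y] using this
  have hxy : x ⬝ᵥ b *ᵥ y = y ⬝ᵥ b *ᵥ x := by
    rw [dotProduct_mulVec, ← mulVec_transpose, hsymm, dotProduct_comm]
  have hpos : 0 < x ⬝ᵥ x + y ⬝ᵥ y := by
    have hxx : 0 ≤ x ⬝ᵥ x := Finset.sum_nonneg fun i _ => mul_self_nonneg _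
    have hyy : 0 ≤ y ⬝ᵥ y := Finset.sum_nonneg fun i _ => mul_self_nonneg _
    refine (add_nonneg hxx hyy).lt_of_ne' fun h0 => hv0 ?_
    have hx0 := dotProduct_self_eq_zero.mp (by linarith : x ⬝ᵥ x = 0)
    have hy0 := dotProduct_self_eq_zero.mp (by linarith : y ⬝ᵥ y = 0)
    ext i
    exact Complex.ext (congrFun hx0 i) (congrFun hy0 i)
  have h1 := h x
  have h2 := h y
  rw [dotProduct_lyapunov_mulVec, hx] at h1
  rw [dotProduct_lyapunov_mulVec, hy] at h2
  simp only [mulVec_sub, mulVec_add, mulVec_smul, dotProduct_sub, sub_dotProduct, dotProduct_add,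
    add_dotProduct, dotProduct_smul, smul_dotProduct, smul_eq_mul, hxy] at h1 h2
  set S := x ⬝ᵥ b *ᵥ x + y ⬝ᵥ b *ᵥ y with hS
  have h3 : m * (x ⬝ᵥ x + y ⬝ᵥ y) ≤ 2 * μ.re * S := by rw [hS]; linarith
  have hS0 : 0 ≤ S := add_nonneg (by simpa using hb.dotProduct_mulVec_nonneg x)
    (by simpa using hb.dotProduct_mulVec_nonneg y)
  have hSle : S ≤ matrixNorm b * (x ⬝ᵥ x + y ⬝ᵥ y) := by
    have := dotProduct_mulVec_le_matrixNorm b x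
    have := dotProduct_mulVec_le_matrixNorm b y
    rw [hS]; linarith
  have h4 : 0 < 2 * μ.re * S := (mul_pos hm hpos).trans_le h3
  have hre : 0 < μ.re := by
    by_contra! hre
    have := mul_nonneg (neg_nonneg.mpr hre) hS0
    linarith
  have h5 : m * (x ⬝ᵥ x + y ⬝ᵥ y) ≤ (μ.re * (2 * matrixNorm b)) * (x ⬝ᵥ x + y ⬝ᵥ y) := by
    have := mul_le_mul_of_nonneg_left hSle hre.le
    linarith
  have h6 := le_of_mul_le_mul_right h5 hpos
  exact div_le_of_le_mul₀ (by unfold matrixNorm; positivity) hre.le h6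

end Spectral

/-! ### The chain with Dirichlet ends -/

/-- The extension of `p₁, …, p_N` to all indices by `0`, indexed from one: `dirichletExt p (i + 1)`
is the value of `p` at the `i`-th element of `Fin N`. The values `0` at `0` and `N + 1` are the fixed
ends of the chain. -/
def dirichletExt {N : ℕ} (p : Fin N → ℝ) (k : ℕ) : ℝ :=
  ∑ j : Fin N, if (j : ℕ) + 1 = k then p j else 0

/-- The skew-symmetric multiplier: a centred difference weighted by the signed distance `j - N / 2`
to the middle of the chain, the discrete analogue of `x ∂ₓ + ∂ₓ x`. -/
noncomputable def multiplier (N : ℕ) : Matrix (Fin N) (Fin N) ℝ :=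
  Matrix.of fun i j =>
    if (i : ℕ) + 1 = (j : ℕ) then ((i : ℕ) + 1 : ℝ) - N / 2
    else if (j : ℕ) + 1 = (i : ℕ) then -(((j : ℕ) + 1 : ℝ) - N / 2) else 0

/-- The sum of the squares of the centred differences `p_{j+1} - p_{j-1}`. -/
def centredEnergy {N : ℕ} (p : Fin N → ℝ) : ℝ :=
  ∑ j ∈ Finset.range N, (dirichletExt p (j + 2) - dirichletExt p j) ^ 2

section Chain

variable {N : ℕ}

@[simp] theorem dirichletExt_zero (p : Fin N → ℝ) : dirichletExt p 0 = 0 := by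
  simp [dirichletExt]

@[simp] theorem dirichletExt_last (p : Fin N → ℝ) : dirichletExt p (N + 1) = 0 :=
  Finset.sum_eq_zero fun j _ => if_neg (by omega)

@[simp] theorem dirichletExt_val_add_one (p : Fin N → ℝ) (i : Fin N) :
    dirichletExt p (i + 1) = p i := by
  simp [dirichletExt, Fin.val_inj]

theorem dotProduct_eq_sum_range (p q : Fin N → ℝ) :
    p ⬝ᵥ q = ∑ j ∈ Finset.range N, dirichletExt p (j + 1) * dirichletExt q (j + 1) := by
  rw [← Fin.sum_univ_eq_sum_range (fun j => dirichletExt p (j + 1) * dirichletExt q (j + 1))]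
  simp [dotProduct]

theorem stiffness_mulVec (a c : ℝ) (p : Fin N → ℝ) (i : Fin N) :
    (stiffness N a c *ᵥ p) i =
      (a + 2 * c) * p i - c * (dirichletExt p (i + 2) + dirichletExt p i) := by
  have h : ∀ j : Fin N, stiffness N a c i j * p j =
      (if j = i then (a + 2 * c) * p j else 0) - c * ((if (j : ℕ) + 1 = i + 2 then p j else 0) +
        if (j : ℕ) + 1 = i then p j else 0) := by
    intro j
    simp only [stiffness, of_apply, Fin.ext_iff]
    split_ifs <;> first | omega | ring
  simp only [mulVec, dotProduct, h, Finset.sum_sub_distrib, ← Finset.mul_sum,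
    Finset.sum_add_distrib, dirichletExt]
  simp

theorem multiplier_mulVec (p : Fin N → ℝ) (i : Fin N) :
    (multiplier N *ᵥ p) i = ((i : ℕ) + 1 - N / 2 : ℝ) * dirichletExt p (i + 2) -
      ((i : ℕ) - N / 2 : ℝ) * dirichletExt p i := by
  have h : ∀ j : Fin N, multiplier N i j * p j =
      ((i : ℕ) + 1 - N / 2 : ℝ) * (if (j : ℕ) + 1 = i + 2 then p j else 0) -
        ((i : ℕ) - N / 2 : ℝ) * if (j : ℕ) + 1 = i then p j else 0 := by
    intro j
    simp only [multiplier, of_apply]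
    split_ifs <;> first | omega | ring1 |
      (rw [← (by assumption : (j : ℕ) + 1 = i)]; push_cast; ring1)
  simp only [mulVec, dotProduct, h, Finset.sum_sub_distrib, ← Finset.mul_sum, dirichletExt]

theorem friction_mulVec (γ : ℝ) (p : Fin N → ℝ) (i : Fin N) :
    (friction N γ *ᵥ p) i = (if (i : ℕ) = 0 ∨ (i : ℕ) + 1 = N then γ else 0) * p i := by
  simp [friction, mulVec_diagonal]

theorem stiffness_transpose (a c : ℝ) : (stiffness N a c)ᵀ = stiffness N a c := by
  ext i j
  simp only [stiffness, transpose_apply, of_apply]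
  grind

theorem dotProduct_stiffness_comm (a c : ℝ) (p q : Fin N → ℝ) :
    p ⬝ᵥ stiffness N a c *ᵥ q = q ⬝ᵥ stiffness N a c *ᵥ p := by
  rw [dotProduct_mulVec, ← mulVec_transpose, stiffness_transpose, dotProduct_comm]

theorem dotProduct_friction_comm (γ : ℝ) (p q : Fin N → ℝ) :
    p ⬝ᵥ friction N γ *ᵥ q = q ⬝ᵥ friction N γ *ᵥ p := by
  simp only [dotProduct, friction_mulVec]
  exact Finset.sum_congr rfl fun i _ => by ring

theorem friction_mulVec_friction_mulVec (γ : ℝ) (p : Fin N → ℝ) :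
    friction N γ *ᵥ (friction N γ *ᵥ p) = γ • friction N γ *ᵥ p := by
  ext i
  simp only [friction_mulVec, Pi.smul_apply, smul_eq_mul]
  split_ifs <;> ring

theorem friction_form_nonneg {γ : ℝ} (hγ : 0 < γ) (p : Fin N → ℝ) :
    0 ≤ p ⬝ᵥ friction N γ *ᵥ p := by
  refine Finset.sum_nonneg fun i _ => ?_
  rw [friction_mulVec]
  split_ifs
  · nlinarith [mul_nonneg hγ.le (mul_self_nonneg (p i))]
  · simp

theorem abs_two_mul_friction_form_le {γ : ℝ} (hγ : 0 < γ) (p q : Fin N → ℝ) :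
    |2 * (p ⬝ᵥ friction N γ *ᵥ q)| ≤ p ⬝ᵥ friction N γ *ᵥ p + q ⬝ᵥ friction N γ *ᵥ q := by
  have h1 := friction_form_nonneg hγ (p + q)
  have h2 := friction_form_nonneg hγ (p - q)
  have h3 := dotProduct_friction_comm γ q p
  simp only [mulVec_add, mulVec_sub, dotProduct_add, add_dotProduct, dotProduct_sub,
    sub_dotProduct] at h1 h2
  rw [abs_le]
  constructor <;> linarith

/-- `|Γ p|² = γ p ⬝ Γ p`. -/
theorem friction_mulVec_dotProduct_self (γ : ℝ) (p : Fin N → ℝ) :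
    (friction N γ *ᵥ p) ⬝ᵥ friction N γ *ᵥ p = γ * (p ⬝ᵥ friction N γ *ᵥ p) := by
  rw [dotProduct_friction_comm, friction_mulVec_friction_mulVec, dotProduct_smul, smul_eq_mul]

theorem friction_form_le {γ : ℝ} (hγ : 0 < γ) (p : Fin N → ℝ) :
    p ⬝ᵥ friction N γ *ᵥ p ≤ γ * (p ⬝ᵥ p) := by
  simp only [dotProduct, friction_mulVec, Finset.mul_sum]
  refine Finset.sum_le_sum fun i _ => ?_
  have := mul_nonneg hγ.le (mul_self_nonneg (p i))
  split_ifs <;> nlinarith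

theorem friction_form_eq (hN : 2 ≤ N) (γ : ℝ) (p : Fin N → ℝ) :
    p ⬝ᵥ friction N γ *ᵥ p = γ * (dirichletExt p 1 ^ 2 + dirichletExt p N ^ 2) := by
  have h0 : dirichletExt p 1 = p ⟨0, by omega⟩ := dirichletExt_val_add_one p ⟨0, by omega⟩
  have h1 : dirichletExt p N = p ⟨N - 1, by omega⟩ := by
    rw [← dirichletExt_val_add_one p ⟨N - 1, by omega⟩]
    congr 1
    simp only
    omega
  have h : ∀ i : Fin N, p i * ((if (i : ℕ) = 0 ∨ (i : ℕ) + 1 = N then γ else 0) * p i) =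
      (if i = ⟨0, by omega⟩ then γ * p i ^ 2 else 0) +
        if i = ⟨N - 1, by omega⟩ then γ * p i ^ 2 else 0 := by
    intro i
    simp only [Fin.ext_iff]
    split_ifs <;> first | omega | ring
  simp only [dotProduct, friction_mulVec, h, Finset.sum_add_distrib, Finset.sum_ite_eq',
    Finset.mem_univ, if_true, h0, h1]
  ring

/-- Shifting the chain to the left does not increase the norm. -/
theorem sum_sq_dirichletExt_add_two_le (p : Fin N → ℝ) :
    ∑ j ∈ Finset.range N, dirichletExt p (j + 2) ^ 2 ≤ p ⬝ᵥ p := by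
  have h := Finset.sum_range_sub (fun j => dirichletExt p (j + 1) ^ 2) N
  rw [Finset.sum_sub_distrib] at h
  simp only [dirichletExt_last, zero_add] at h
  rw [dotProduct_eq_sum_range]
  simp only [← sq]
  linarith [sq_nonneg (dirichletExt p 1)]

/-- Shifting the chain to the right does not increase the norm. -/
theorem sum_sq_dirichletExt_le (p : Fin N → ℝ) :
    ∑ j ∈ Finset.range N, dirichletExt p j ^ 2 ≤ p ⬝ᵥ p := by
  have h := Finset.sum_range_sub (fun j => dirichletExt p j ^ 2) N
  rw [Finset.sum_sub_distrib] at h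
  simp only [dirichletExt_zero] at h
  rw [dotProduct_eq_sum_range]
  simp only [← sq]
  linarith [sq_nonneg (dirichletExt p N)]

theorem stiffness_form_eq (a c : ℝ) (p : Fin N → ℝ) :
    p ⬝ᵥ stiffness N a c *ᵥ p = ∑ j ∈ Finset.range N, dirichletExt p (j + 1) *
      ((a + 2 * c) * dirichletExt p (j + 1) - c * (dirichletExt p (j + 2) + dirichletExt p j)) := by
  rw [← Fin.sum_univ_eq_sum_range (fun j => dirichletExt p (j + 1) *
      ((a + 2 * c) * dirichletExt p (j + 1) - c * (dirichletExt p (j + 2) + dirichletExt p j)))]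
  simp [dotProduct, stiffness_mulVec]

theorem le_stiffness_form (a : ℝ) {c : ℝ} (hc : 0 < c) (p : Fin N → ℝ) :
    a * (p ⬝ᵥ p) ≤ p ⬝ᵥ stiffness N a c *ᵥ p := by
  have h1 := mul_le_mul_of_nonneg_left (sum_sq_dirichletExt_add_two_le p) hc.le
  have h2 := mul_le_mul_of_nonneg_left (sum_sq_dirichletExt_le p) hc.le
  have h3 : ∑ j ∈ Finset.range N, ((a + c) * (dirichletExt p (j + 1) * dirichletExt p (j + 1)) -
      c / 2 * dirichletExt p (j + 2) ^ 2 - c / 2 * dirichletExt p j ^ 2) ≤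
      p ⬝ᵥ stiffness N a c *ᵥ p := by
    rw [stiffness_form_eq]
    refine Finset.sum_le_sum fun j _ => ?_
    nlinarith [mul_nonneg hc.le (sq_nonneg (dirichletExt p (j + 1) - dirichletExt p (j + 2))),
      mul_nonneg hc.le (sq_nonneg (dirichletExt p (j + 1) - dirichletExt p j))]
  simp only [Finset.sum_sub_distrib, ← Finset.mul_sum] at h3
  rw [← dotProduct_eq_sum_range] at h3
  linarith

theorem stiffness_form_le (a : ℝ) {c : ℝ} (hc : 0 < c) (p : Fin N → ℝ) :
    p ⬝ᵥ stiffness N a c *ᵥ p ≤ (a + 4 * c) * (p ⬝ᵥ p) := by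
  have h1 := mul_le_mul_of_nonneg_left (sum_sq_dirichletExt_add_two_le p) hc.le
  have h2 := mul_le_mul_of_nonneg_left (sum_sq_dirichletExt_le p) hc.le
  have h3 : p ⬝ᵥ stiffness N a c *ᵥ p ≤
      ∑ j ∈ Finset.range N, ((a + 3 * c) * (dirichletExt p (j + 1) * dirichletExt p (j + 1)) +
        c / 2 * dirichletExt p (j + 2) ^ 2 + c / 2 * dirichletExt p j ^ 2) := by
    rw [stiffness_form_eq]
    refine Finset.sum_le_sum fun j _ => ?_
    nlinarith [mul_nonneg hc.le (sq_nonneg (dirichletExt p (j + 1) + dirichletExt p (j + 2))),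
      mul_nonneg hc.le (sq_nonneg (dirichletExt p (j + 1) + dirichletExt p j))]
  simp only [Finset.sum_add_distrib, ← Finset.mul_sum] at h3
  rw [← dotProduct_eq_sum_range] at h3
  linarith

theorem stiffness_posDef {a c : ℝ} (ha : 0 < a) (hc : 0 < c) : (stiffness N a c).PosDef := by
  refine .of_dotProduct_mulVec_pos (by simpa [IsHermitian] using stiffness_transpose a c)
    fun z hz => ?_
  have h1 := le_stiffness_form a hc z
  have h2 : 0 < z ⬝ᵥ z := by simpa using dotProduct_star_self_pos_iff.mpr hz
  simpa using (mul_pos ha h2).trans_le h1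

theorem stiffness_inv_mulVec {a c : ℝ} (ha : 0 < a) (hc : 0 < c) (p : Fin N → ℝ) :
    (stiffness N a c)⁻¹ *ᵥ (stiffness N a c *ᵥ p) = p := by
  rw [mulVec_mulVec, nonsing_inv_mul _ ((isUnit_iff_isUnit_det _).mp (stiffness_posDef ha hc).isUnit),
    one_mulVec]

theorem stiffness_mulVec_inv {a c : ℝ} (ha : 0 < a) (hc : 0 < c) (p : Fin N → ℝ) :
    stiffness N a c *ᵥ ((stiffness N a c)⁻¹ *ᵥ p) = p := by
  rw [mulVec_mulVec, mul_nonsing_inv _ ((isUnit_iff_isUnit_det _).mp (stiffness_posDef ha hc).isUnit),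
    one_mulVec]

theorem stiffness_inv_form_nonneg {a c : ℝ} (ha : 0 < a) (hc : 0 < c) (q : Fin N → ℝ) :
    0 ≤ q ⬝ᵥ (stiffness N a c)⁻¹ *ᵥ q := by
  simpa using (stiffness_posDef ha hc).inv.posSemidef.dotProduct_mulVec_nonneg q

theorem stiffness_inv_form_le {a c : ℝ} (ha : 0 < a) (hc : 0 < c) (q : Fin N → ℝ) :
    q ⬝ᵥ (stiffness N a c)⁻¹ *ᵥ q ≤ q ⬝ᵥ q / a := by
  set x := (stiffness N a c)⁻¹ *ᵥ q with hx
  have h1 := le_stiffness_form a hc x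
  rw [hx, stiffness_mulVec_inv ha hc, ← hx] at h1
  have h2 : 0 ≤ (a • x - q) ⬝ᵥ (a • x - q) := Finset.sum_nonneg fun i _ => mul_self_nonneg _
  simp only [dotProduct_sub, sub_dotProduct, dotProduct_smul, smul_dotProduct, smul_eq_mul] at h2
  have h3 := mul_le_mul_of_nonneg_left h1 ha.le
  rw [dotProduct_comm x q] at *
  rw [le_div_iff₀ ha]
  linarith

/-! ### The multiplier identities -/

theorem multiplier_form_eq (p q : Fin N → ℝ) :
    q ⬝ᵥ multiplier N *ᵥ p = ∑ j ∈ Finset.range N, dirichletExt q (j + 1) *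
      ((j + 1 - N / 2 : ℝ) * dirichletExt p (j + 2) - (j - N / 2 : ℝ) * dirichletExt p j) := by
  rw [← Fin.sum_univ_eq_sum_range (fun j => dirichletExt q (j + 1) *
      ((j + 1 - N / 2 : ℝ) * dirichletExt p (j + 2) - (j - N / 2 : ℝ) * dirichletExt p j))]
  simp [dotProduct, multiplier_mulVec]

theorem multiplier_form_self (p : Fin N → ℝ) : p ⬝ᵥ multiplier N *ᵥ p = 0 := by
  have h := Finset.sum_range_sub
    (fun j => ((j : ℝ) - N / 2) * (dirichletExt p j * dirichletExt p (j + 1))) N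
  simp only [dirichletExt_zero, dirichletExt_last, zero_mul, mul_zero, sub_zero] at h
  rw [multiplier_form_eq, ← h]
  refine Finset.sum_congr rfl fun j _ => ?_
  push_cast
  ring

theorem abs_multiplier_form_le (p q : Fin N → ℝ) :
    |q ⬝ᵥ multiplier N *ᵥ p| ≤ N / 2 * (q ⬝ᵥ q + p ⬝ᵥ p) := by
  have hb : ∀ w x y : ℝ, |w| ≤ N / 2 → |x * (w * y)| ≤ N / 4 * (x * x + y ^ 2) := by
    intro w x y hw
    have h1 : |x * (w * y)| = |w| * (|x| * |y|) := by rw [abs_mul, abs_mul]; ring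
    have h2 : |x| * |y| ≤ (x * x + y ^ 2) / 2 := by
      nlinarith [sq_nonneg (|x| - |y|), sq_abs x, sq_abs y]
    rw [h1]
    calc |w| * (|x| * |y|) ≤ N / 2 * ((x * x + y ^ 2) / 2) :=
          mul_le_mul hw h2 (by positivity) (by positivity)
      _ = _ := by ring
  have hsum : |q ⬝ᵥ multiplier N *ᵥ p| ≤ ∑ j ∈ Finset.range N,
      (N / 2 * (dirichletExt q (j + 1) * dirichletExt q (j + 1)) +
        N / 4 * dirichletExt p (j + 2) ^ 2 + N / 4 * dirichletExt p j ^ 2) := by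
    rw [multiplier_form_eq]
    refine (Finset.abs_sum_le_sum_abs _ _).trans (Finset.sum_le_sum fun j hj => ?_)
    have hj : (j : ℝ) + 1 ≤ N := by exact_mod_cast Finset.mem_range.mp hj
    have hj0 : (0 : ℝ) ≤ j := j.cast_nonneg
    have h1 := hb (j + 1 - N / 2) (dirichletExt q (j + 1)) (dirichletExt p (j + 2))
      (abs_le.mpr ⟨by linarith, by linarith⟩)
    have h2 := hb (j - N / 2) (dirichletExt q (j + 1)) (dirichletExt p j)
      (abs_le.mpr ⟨by linarith, by linarith⟩)
    rw [mul_sub]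
    refine (abs_sub _ _).trans ?_
    linarith
  simp only [Finset.sum_add_distrib, ← Finset.mul_sum] at hsum
  rw [← dotProduct_eq_sum_range] at hsum
  have h1 := mul_le_mul_of_nonneg_left (sum_sq_dirichletExt_add_two_le p)
    (by positivity : (0 : ℝ) ≤ N / 4)
  have h2 := mul_le_mul_of_nonneg_left (sum_sq_dirichletExt_le p)
    (by positivity : (0 : ℝ) ≤ N / 4)
  linarith

/-- The commutator identity: `B p ⬝ K p` is the energy of the centred differences of `p` up to a
boundary term, which the friction controls. The summands differ from the squares of the centred
differences by the telescoping `g (j + 2) - g j` with `g j = (j - N / 2 - 1 / 2) p_j²`. -/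
theorem stiffness_dotProduct_multiplier (hN : 2 ≤ N) (a c : ℝ) {γ : ℝ} (hγ : 0 < γ)
    (p : Fin N → ℝ) :
    (stiffness N a c *ᵥ p) ⬝ᵥ multiplier N *ᵥ p =
      c / 2 * centredEnergy p - c * (N - 1) / (2 * γ) * (p ⬝ᵥ friction N γ *ᵥ p) := by
  set P := dirichletExt p with hP
  set g : ℕ → ℝ := fun j => ((j : ℝ) - N / 2 - 1 / 2) * P j ^ 2 with hg
  have htel : ∑ j ∈ Finset.range N, (g (j + 2) - g j) =
      (N - 1) / 2 * (P 1 ^ 2 + P N ^ 2) := by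
    have h1 := Finset.sum_range_sub g N
    have h2 := Finset.sum_range_sub (fun j => g (j + 1)) N
    have h3 : ∑ j ∈ Finset.range N, (g (j + 2) - g j) =
        ∑ j ∈ Finset.range N, (g (j + 1 + 1) - g (j + 1)) +
          ∑ j ∈ Finset.range N, (g (j + 1) - g j) := by
      rw [← Finset.sum_add_distrib]
      exact Finset.sum_congr rfl fun j _ => by ring
    rw [h3, h1, h2]
    simp only [hg, hP, dirichletExt_last, dirichletExt_zero]
    push_cast
    ring
  have hsum : (stiffness N a c *ᵥ p) ⬝ᵥ multiplier N *ᵥ p =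
      (a + 2 * c) * (p ⬝ᵥ multiplier N *ᵥ p) + ∑ j ∈ Finset.range N,
        (c / 2 * (P (j + 2) - P j) ^ 2 - c * (g (j + 2) - g j)) := by
    rw [← Fin.sum_univ_eq_sum_range (fun j => c / 2 * (P (j + 2) - P j) ^ 2 - c * (g (j + 2) - g j))]
    simp only [dotProduct, stiffness_mulVec, multiplier_mulVec, Finset.mul_sum]
    rw [← Finset.sum_add_distrib]
    refine Finset.sum_congr rfl fun i _ => ?_
    simp only [hg, hP]
    push_cast
    ring
  rw [hsum, multiplier_form_self, Finset.sum_sub_distrib, ← Finset.mul_sum, ← Finset.mul_sum, htel,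
    friction_form_eq hN, centredEnergy]
  field_simp
  ring

/-- At the two ends of the chain `K p` is a multiple of the off-diagonal part of `B p`, as the
weights there are `±(N - 2) / 2` and the outer neighbours vanish. -/
theorem friction_multiplier_eq (a c γ : ℝ) (p r : Fin N → ℝ) :
    c * ((friction N γ *ᵥ r) ⬝ᵥ multiplier N *ᵥ p) = (N - 2) / 2 *
      (r ⬝ᵥ friction N γ *ᵥ (stiffness N a c *ᵥ p) - (a + 2 * c) * (r ⬝ᵥ friction N γ *ᵥ p)) := by
  simp only [dotProduct, friction_mulVec, stiffness_mulVec, multiplier_mulVec, mul_sub,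
    Finset.mul_sum, ← Finset.sum_sub_distrib]
  refine Finset.sum_congr rfl fun i _ => ?_
  split_ifs with h
  · rcases h with h | h
    · simp only [h, dirichletExt_zero]
      push_cast
      ring
    · have h2 : dirichletExt p (i + 2) = 0 := by
        rw [show (i : ℕ) + 2 = N + 1 by omega, dirichletExt_last]
      have h3 : (i : ℝ) = N - 1 := by
        have : ((i : ℕ) + 1 : ℝ) = N := by exact_mod_cast h
        linarith
      rw [h2, h3]
      ring
  · ring

/-- Discrete Poincaré inequality for centred differences. These relate sites of equal parity, so the
odd sites are not anchored by the fixed end and `p₁` has to enter. -/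
theorem dotProduct_self_le_centredEnergy (p : Fin N → ℝ) :
    p ⬝ᵥ p ≤ 2 * N * dirichletExt p 1 ^ 2 + 2 * N ^ 2 * centredEnergy p := by
  set P := dirichletExt p with hP
  set S : ℕ → ℝ := fun k => ∑ j ∈ Finset.range k, |P (j + 2) - P j| with hS
  have hSsucc : ∀ k, S (k + 1) = S k + |P (k + 2) - P k| := fun k => Finset.sum_range_succ _ _
  have hS0 : ∀ k, 0 ≤ S k := fun k => Finset.sum_nonneg fun _ _ => abs_nonneg _
  have hstep : ∀ k, |P k| ≤ |P 1| + S (k - 1) ∧ |P (k + 1)| ≤ |P 1| + S k := by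
    intro k
    induction k with
    | zero => simp [hP, hS]
    | succ k ih =>
      refine ⟨by simpa using ih.2, ?_⟩
      have h1 : |P (k + 2)| ≤ |P k| + |P (k + 2) - P k| := by
        have := abs_add_le (P k) (P (k + 2) - P k)
        simpa using this
      have h2 : S (k - 1) ≤ S k :=
        Finset.sum_le_sum_of_subset_of_nonneg (Finset.range_mono (Nat.sub_le k 1))
          fun _ _ _ => abs_nonneg _
      rw [hSsucc]
      linarith [ih.1]
  have hCS : S N ^ 2 ≤ N * centredEnergy p := by
    have := sq_sum_le_card_mul_sum_sq (s := Finset.range N) (f := fun j => |P (j + 2) - P j|)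
    simpa [sq_abs, hS, centredEnergy, ← hP] using this
  have hterm : ∀ j ∈ Finset.range N, P (j + 1) * P (j + 1) ≤
      2 * P 1 ^ 2 + 2 * (N * centredEnergy p) := by
    intro j hj
    have h1 : S j ≤ S N :=
      Finset.sum_le_sum_of_subset_of_nonneg (Finset.range_mono (Finset.mem_range.mp hj).le)
        fun _ _ _ => abs_nonneg _
    have h2 : |P (j + 1)| ≤ |P 1| + S N := (hstep j).2.trans (by linarith)
    have h3 : P (j + 1) ^ 2 ≤ (|P 1| + S N) ^ 2 := by
      rw [← sq_abs]
      exact pow_le_pow_left₀ (abs_nonneg _) h2 2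
    nlinarith [sq_nonneg (|P 1| - S N), sq_abs (P 1)]
  rw [dotProduct_eq_sum_range]
  refine (Finset.sum_le_sum hterm).trans_eq ?_
  simp
  ring

end Chain

/-! ### The Lyapunov function of the chain -/

/-- The Lyapunov function, with `p' = r = q - Γ p` along the flow. With `s = (N - 2) / 2`
its form is `β (|p|² + q ⬝ B⁻¹ q + |r|² + p ⬝ B p) + α (r ⬝ K p - (s / 2c) r ⬝ Γ r) - 2 r ⬝ p`:
two energies, the multiplier with a boundary correction, and the equipartition term. The change of
variables from `(p, q)` to `(p, r)` is the outer factor of the second summand. -/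
noncomputable def lyapunov (N : ℕ) (a c γ α β : ℝ) : Matrix (Fin N ⊕ Fin N) (Fin N ⊕ Fin N) ℝ :=
  β • fromBlocks 1 0 0 (stiffness N a c)⁻¹ +
    (fromBlocks 1 0 (-friction N γ) 1)ᵀ *
      fromBlocks (β • stiffness N a c) 0 (α • multiplier N - (2 : ℝ) • 1)
        (β • 1 - (α * ((N - 2) / 2) / (2 * c)) • friction N γ) *
      fromBlocks 1 0 (-friction N γ) 1

section Lyapunov

variable {N : ℕ} {a c γ : ℝ}

theorem drift_mulVec (p q : Fin N → ℝ) : drift N a c γ *ᵥ Sum.elim p q =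
    Sum.elim (friction N γ *ᵥ p - q) (stiffness N a c *ᵥ p) := by
  simp [drift, fromBlocks_mulVec, neg_mulVec, sub_eq_add_neg]

theorem lyapunov_form (α β : ℝ) (p q p' q' : Fin N → ℝ) :
    Sum.elim p q ⬝ᵥ lyapunov N a c γ α β *ᵥ Sum.elim p' q' =
      β * (p ⬝ᵥ p' + q ⬝ᵥ (stiffness N a c)⁻¹ *ᵥ q') + β * (p ⬝ᵥ stiffness N a c *ᵥ p') +
      (α * ((q - friction N γ *ᵥ p) ⬝ᵥ multiplier N *ᵥ p') -
        2 * ((q - friction N γ *ᵥ p) ⬝ᵥ p')) +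
      (β * ((q - friction N γ *ᵥ p) ⬝ᵥ (q' - friction N γ *ᵥ p')) -
        α * ((N - 2) / 2) / (2 * c) * ((q - friction N γ *ᵥ p) ⬝ᵥ
          friction N γ *ᵥ (q' - friction N γ *ᵥ p'))) := by
  have hT : ∀ x y : Fin N → ℝ, fromBlocks 1 0 (-friction N γ) 1 *ᵥ Sum.elim x y =
      Sum.elim x (y - friction N γ *ᵥ x) := by
    intro x y
    simp [fromBlocks_mulVec, neg_mulVec, sub_eq_add_neg, add_comm]
  rw [lyapunov, add_mulVec, dotProduct_add, ← mulVec_mulVec, ← mulVec_mulVec, hT,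
    dotProduct_mulVec _ (_ᵀ), vecMul_transpose, hT, smul_mulVec, dotProduct_smul,
    sumElim_dotProduct_fromBlocks_mulVec, sumElim_dotProduct_fromBlocks_mulVec]
  simp only [smul_mulVec, sub_mulVec, one_mulVec, zero_mulVec, dotProduct_zero, dotProduct_sub,
    dotProduct_smul, smul_eq_mul, add_zero]
  ring

/-- The dissipation rate of the Lyapunov function. -/
theorem lyapunov_dissipation (hN : 2 ≤ N) (ha : 0 < a) (hc : 0 < c) (hγ : 0 < γ) (α β : ℝ)
    (p q r : Fin N → ℝ) (hr : r = q - friction N γ *ᵥ p) :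
    Sum.elim p q ⬝ᵥ lyapunov N a c γ α β *ᵥ (drift N a c γ *ᵥ Sum.elim p q) +
        (drift N a c γ *ᵥ Sum.elim p q) ⬝ᵥ lyapunov N a c γ α β *ᵥ Sum.elim p q =
      2 * β * (p ⬝ᵥ friction N γ *ᵥ p + r ⬝ᵥ friction N γ *ᵥ r) + 2 * (r ⬝ᵥ r) +
      α * (c / 2 * centredEnergy p - c * (N - 1) / (2 * γ) * (p ⬝ᵥ friction N γ *ᵥ p) -
        (N - 2) / 2 / c * ((a + 2 * c) * (r ⬝ᵥ friction N γ *ᵥ p) +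
          γ * (r ⬝ᵥ friction N γ *ᵥ r))) -
      2 * (p ⬝ᵥ stiffness N a c *ᵥ p) - 2 * (r ⬝ᵥ friction N γ *ᵥ p) := by
  obtain rfl : q = r + friction N γ *ᵥ p := by rw [hr]; abel
  have e1 : ∀ x : Fin N → ℝ, friction N γ *ᵥ x - (r + friction N γ *ᵥ x) = -r := fun x => by abel
  have e2 : ∀ x : Fin N → ℝ, stiffness N a c *ᵥ x - friction N γ *ᵥ (-r) =
      stiffness N a c *ᵥ x + friction N γ *ᵥ r := fun x => by rw [mulVec_neg, sub_neg_eq_add]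
  have e3 : ∀ x : Fin N → ℝ, x ⬝ᵥ friction N γ *ᵥ (friction N γ *ᵥ r) =
      γ * (x ⬝ᵥ friction N γ *ᵥ r) := fun x => by
    rw [friction_mulVec_friction_mulVec, dotProduct_smul, smul_eq_mul]
  have f1 := stiffness_dotProduct_multiplier hN a c hγ p
  have f2 := friction_multiplier_eq a c γ p r
  have f3 := multiplier_form_self r
  have f4 : (stiffness N a c *ᵥ p) ⬝ᵥ (stiffness N a c)⁻¹ *ᵥ (r + friction N γ *ᵥ p) =
      p ⬝ᵥ (r + friction N γ *ᵥ p) := by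
    rw [dotProduct_comm (stiffness N a c *ᵥ p), dotProduct_stiffness_comm,
      stiffness_mulVec_inv ha hc]
  have f5 : (friction N γ *ᵥ r) ⬝ᵥ multiplier N *ᵥ p = (N - 2) / 2 / c *
      (r ⬝ᵥ friction N γ *ᵥ (stiffness N a c *ᵥ p) - (a + 2 * c) * (r ⬝ᵥ friction N γ *ᵥ p)) := by
    rw [div_mul_eq_mul_div, ← f2]
    field_simp
  have f6 : (stiffness N a c *ᵥ p) ⬝ᵥ friction N γ *ᵥ r =
      r ⬝ᵥ friction N γ *ᵥ (stiffness N a c *ᵥ p) := dotProduct_friction_comm _ _ _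
  have f7 : (friction N γ *ᵥ r) ⬝ᵥ friction N γ *ᵥ r = γ * (r ⬝ᵥ friction N γ *ᵥ r) :=
    friction_mulVec_dotProduct_self _ _
  have f8 := dotProduct_stiffness_comm a c r p
  have f9 := dotProduct_friction_comm γ p r
  rw [drift_mulVec, lyapunov_form, lyapunov_form, e1, e2, f4, stiffness_inv_mulVec ha hc,
    add_sub_cancel_right]
  simp only [mulVec_add, mulVec_neg, dotProduct_add, add_dotProduct, dotProduct_neg,
    neg_dotProduct, e3, f1, f3, f5, f6, f7, f8, f9, dotProduct_comm p r,
    dotProduct_comm (stiffness N a c *ᵥ p) r, dotProduct_comm (friction N γ *ᵥ r),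
    dotProduct_comm (friction N γ *ᵥ p), dotProduct_comm (stiffness N a c *ᵥ p) p]
  field_simp
  ring

/-- With `α` of order `N²` and `β` of order `N³` the Lyapunov function dissipates at least `|z|²`,
is positive definite, and is of order `N³`. -/
theorem exists_lyapunov_bounds (ha : 0 < a) (hc : 0 < c) (hγ : 0 < γ) :
    ∃ C : ℝ, 0 < C ∧ ∀ N : ℕ, 2 ≤ N → ∃ W : Matrix (Fin N ⊕ Fin N) (Fin N ⊕ Fin N) ℝ,
      (∀ z, z ⬝ᵥ z ≤ z ⬝ᵥ W *ᵥ (drift N a c γ *ᵥ z) + (drift N a c γ *ᵥ z) ⬝ᵥ W *ᵥ z) ∧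
      (∀ z, z ≠ 0 → 0 < z ⬝ᵥ W *ᵥ z) ∧ ∀ z, z ⬝ᵥ W *ᵥ z ≤ C * (N : ℝ) ^ 3 * (z ⬝ᵥ z) := by
  -- the weight of `|p|²` needed to absorb `2 p ⬝ B p` and leave `|p|²`
  set L : ℝ := 1 + 2 * (a + 4 * c) with hL
  have hL0 : 0 < L := by positivity
  -- the first six terms dominate the friction terms of the dissipation rate, and the last three
  -- the indefinite terms of the form itself
  set C₁ : ℝ := 2 * L / γ + L * (a + 2 * c) / c ^ 2 + 1 + 2 * L / γ + 2 * γ + 2 * L * γ / c ^ 2 +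
    2 * L / c + 2 with hC₁
  have hC₁0 : 0 < C₁ := by positivity
  refine ⟨C₁ * (1 + 1 / a + (a + 4 * c)) + (2 * L / c + 1) +
    (2 * L / c + 1 + C₁) * (2 + 2 * γ ^ 2), by positivity, fun N hN => ?_⟩
  have hN1 : (2 : ℝ) ≤ N := by exact_mod_cast hN
  have hN3 : (1 : ℝ) ≤ (N : ℝ) ^ 3 := one_le_pow₀ (by linarith)
  have hNN3 : (N : ℝ) ≤ (N : ℝ) ^ 3 := le_self_pow₀ (by linarith) (by norm_num)
  set α : ℝ := 4 * L * (N : ℝ) ^ 2 / c with hα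
  set β : ℝ := C₁ * (N : ℝ) ^ 3 with hβ
  have hα0 : 0 < α := by positivity
  have hβ0 : 0 < β := by positivity
  have hnn : ∀ v : Fin N → ℝ, 0 ≤ v ⬝ᵥ v := fun v => Finset.sum_nonneg fun i _ => mul_self_nonneg _
  have hself : ∀ z : Fin N ⊕ Fin N → ℝ, ∃ p q : Fin N → ℝ, z = Sum.elim p q ∧
      z ⬝ᵥ z = p ⬝ᵥ p + q ⬝ᵥ q := fun z =>
    ⟨z ∘ Sum.inl, z ∘ Sum.inr, (Sum.elim_comp_inl_inr z).symm, by
      conv_lhs => rw [← Sum.elim_comp_inl_inr z, sumElim_dotProduct_sumElim]⟩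
  have hform : ∀ p q : Fin N → ℝ, ∀ r : Fin N → ℝ, r = q - friction N γ *ᵥ p →
      Sum.elim p q ⬝ᵥ lyapunov N a c γ α β *ᵥ Sum.elim p q =
      β * (p ⬝ᵥ p + q ⬝ᵥ (stiffness N a c)⁻¹ *ᵥ q) + β * (p ⬝ᵥ stiffness N a c *ᵥ p) +
      (α * (r ⬝ᵥ multiplier N *ᵥ p) - 2 * (r ⬝ᵥ p)) +
      (β * (r ⬝ᵥ r) - α * ((N - 2) / 2) / (2 * c) * (r ⬝ᵥ friction N γ *ᵥ r)) := by
    rintro p q r rfl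
    exact lyapunov_form α β p q p q
  -- the indefinite terms of the form, against `|p|² + |r|²`
  have hmul : ∀ p r : Fin N → ℝ, |α * (r ⬝ᵥ multiplier N *ᵥ p) - 2 * (r ⬝ᵥ p)| ≤
      (2 * L / c + 1) * (N : ℝ) ^ 3 * (r ⬝ᵥ r + p ⬝ᵥ p) := by
    intro p r
    have h1 := mul_le_mul_of_nonneg_left (abs_multiplier_form_le p r) hα0.le
    have h2 : |2 * (r ⬝ᵥ p)| ≤ r ⬝ᵥ r + p ⬝ᵥ p := by
      have h3 := hnn (r + p)
      have h4 := hnn (r - p)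
      simp only [dotProduct_add, add_dotProduct, dotProduct_sub, sub_dotProduct,
        dotProduct_comm p r] at h3 h4
      rw [abs_le]
      constructor <;> linarith
    have h3 : α * (N / 2 * (r ⬝ᵥ r + p ⬝ᵥ p)) = 2 * L / c * (N : ℝ) ^ 3 * (r ⬝ᵥ r + p ⬝ᵥ p) := by
      rw [hα]; field_simp; ring
    have h4 := mul_le_mul_of_nonneg_right hN3 (add_nonneg (hnn r) (hnn p))
    refine (abs_sub _ _).trans ?_
    rw [abs_mul α, abs_of_pos hα0]
    linarith
  have hs : α * ((N - 2) / 2) / (2 * c) ≤ L / c ^ 2 * (N : ℝ) ^ 3 := by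
    have : L / c ^ 2 * (N : ℝ) ^ 3 - α * ((N - 2) / 2) / (2 * c) = 2 * L * (N : ℝ) ^ 2 / c ^ 2 := by
      rw [hα]; field_simp; ring
    have h0 : 0 ≤ 2 * L * (N : ℝ) ^ 2 / c ^ 2 := by positivity
    linarith
  have hs0 : 0 ≤ α * ((N - 2) / 2) / (2 * c) :=
    div_nonneg (mul_nonneg hα0.le (by linarith)) (by linarith)
  refine ⟨lyapunov N a c γ α β, fun z => ?_, fun z hz => ?_, fun z => ?_⟩
  · obtain ⟨p, q, rfl, hz⟩ := hself z
    rw [hz]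
    obtain ⟨r, hr⟩ : ∃ r, r = q - friction N γ *ᵥ p := ⟨_, rfl⟩
    rw [lyapunov_dissipation hN ha hc hγ α β p q r hr]
    have hg := friction_form_nonneg hγ p
    have hh := friction_form_nonneg hγ r
    have hk := abs_two_mul_friction_form_le hγ r p
    have hx := stiffness_form_le a hc p
    have hS := dotProduct_self_le_centredEnergy p
    have hg1 : γ * dirichletExt p 1 ^ 2 ≤ p ⬝ᵥ friction N γ *ᵥ p := by
      rw [friction_form_eq hN]
      have := mul_nonneg hγ.le (sq_nonneg (dirichletExt p N))
      linarith
    have hq : q ⬝ᵥ q ≤ 2 * (r ⬝ᵥ r) + 2 * γ * (p ⬝ᵥ friction N γ *ᵥ p) := by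
      obtain rfl : q = r + friction N γ *ᵥ p := by rw [hr]; abel
      have h1 := hnn (r - friction N γ *ᵥ p)
      have h2 := friction_mulVec_dotProduct_self γ p
      simp only [dotProduct_add, add_dotProduct, dotProduct_sub, sub_dotProduct] at h1 ⊢
      linarith
    generalize p ⬝ᵥ friction N γ *ᵥ p = g at *
    generalize r ⬝ᵥ friction N γ *ᵥ r = h at *
    generalize r ⬝ᵥ friction N γ *ᵥ p = k at *
    generalize p ⬝ᵥ stiffness N a c *ᵥ p = x at *
    generalize p ⬝ᵥ p = S at *
    generalize r ⬝ᵥ r = R at *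
    generalize q ⬝ᵥ q = Q at *
    generalize centredEnergy p = D at *
    generalize dirichletExt p 1 ^ 2 = b at *
    have hk1 := (abs_le.mp hk).2
    have hD : L * S - 2 * L / γ * (N : ℝ) ^ 3 * g ≤ α * (c / 2 * D) := by
      have h1 : α * (c / 2 * D) = L * (2 * (N : ℝ) ^ 2 * D) := by rw [hα]; field_simp; ring
      have h2 := mul_le_mul_of_nonneg_left hS hL0.le
      have h3 : L * (2 * N * b) ≤ 2 * L / γ * (N : ℝ) ^ 3 * g := by
        have h4 : L * (2 * N * b) = 2 * L / γ * N * (γ * b) := by field_simp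
        rw [h4]
        refine (mul_le_mul_of_nonneg_left hg1 (by positivity)).trans ?_
        exact mul_le_mul_of_nonneg_right (mul_le_mul_of_nonneg_left hNN3 (by positivity)) hg
      linarith
    have hgα : α * (c * (N - 1) / (2 * γ) * g) ≤ 2 * L / γ * (N : ℝ) ^ 3 * g := by
      have h1 : 2 * L / γ * (N : ℝ) ^ 3 * g - α * (c * (N - 1) / (2 * γ) * g) =
          2 * L / γ * (N : ℝ) ^ 2 * g := by
        rw [hα]; field_simp; ring
      have : 0 ≤ 2 * L / γ * (N : ℝ) ^ 2 * g := by positivity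
      linarith
    have hkα : α * ((N - 2) / 2 / c * ((a + 2 * c) * k + γ * h)) ≤
        L / c ^ 2 * (N : ℝ) ^ 3 * ((a + 2 * c) * (g + h) + 2 * γ * h) := by
      have h1 : α * ((N - 2) / 2 / c * ((a + 2 * c) * k + γ * h)) =
          α * ((N - 2) / 2) / (2 * c) * ((a + 2 * c) * (2 * k) + 2 * γ * h) := by field_simp
      have h2 : (a + 2 * c) * (2 * k) ≤ (a + 2 * c) * (g + h) :=
        mul_le_mul_of_nonneg_left (by linarith) (by positivity)
      rw [h1]
      refine (mul_le_mul_of_nonneg_left (add_le_add_left h2 _) hs0).trans ?_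
      exact mul_le_mul_of_nonneg_right hs (by positivity)
    have hgN := mul_le_mul_of_nonneg_right hN3 hg
    have hhN := mul_le_mul_of_nonneg_right hN3 hh
    have hgN' := mul_le_mul_of_nonneg_left hgN (by positivity : 0 ≤ 1 + 2 * γ)
    have hβg : β * g = C₁ * ((N : ℝ) ^ 3 * g) := by rw [hβ]; ring
    have hβh : β * h = C₁ * ((N : ℝ) ^ 3 * h) := by rw [hβ]; ring
    have hG : 0 ≤ (N : ℝ) ^ 3 * g := by positivity
    have hH : 0 ≤ (N : ℝ) ^ 3 * h := by positivity
    have hCg : (4 * L / γ + L / c ^ 2 * (a + 2 * c) + (1 + 2 * γ)) * ((N : ℝ) ^ 3 * g) ≤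
        2 * C₁ * ((N : ℝ) ^ 3 * g) := by
      refine mul_le_mul_of_nonneg_right ?_ hG
      have h1 : 0 ≤ L * (a + 2 * c) / c ^ 2 := by positivity
      have h2 : 0 ≤ 2 * L * γ / c ^ 2 := by positivity
      have h3 : 0 ≤ 2 * L / c := by positivity
      have h4 : 0 ≤ 2 * L / γ := by positivity
      have h5 : 4 * L / γ = 2 * (2 * L / γ) := by ring
      have h6 : L / c ^ 2 * (a + 2 * c) = L * (a + 2 * c) / c ^ 2 := by ring
      rw [h5, h6, hC₁]
      linarith
    have hCh : (L / c ^ 2 * (a + 2 * c) + L / c ^ 2 * (2 * γ) + 1) * ((N : ℝ) ^ 3 * h) ≤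
        2 * C₁ * ((N : ℝ) ^ 3 * h) := by
      refine mul_le_mul_of_nonneg_right ?_ hH
      have h1 : 0 ≤ L * (a + 2 * c) / c ^ 2 := by positivity
      have h2 : 0 ≤ 2 * L * γ / c ^ 2 := by positivity
      have h3 : 0 ≤ 2 * L / c := by positivity
      have h4 : 0 ≤ 2 * L / γ := by positivity
      have h5 : L / c ^ 2 * (2 * γ) = 2 * L * γ / c ^ 2 := by ring
      have h6 : L / c ^ 2 * (a + 2 * c) = L * (a + 2 * c) / c ^ 2 := by ring
      rw [h5, h6, hC₁]
      linarith
    have hLS : L * S = S + 2 * ((a + 4 * c) * S) := by rw [hL]; ring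
    have e1 : 4 * L / γ * ((N : ℝ) ^ 3 * g) = 2 * (2 * L / γ * (N : ℝ) ^ 3 * g) := by ring
    linarith
  · obtain ⟨p, q, rfl, -⟩ := hself z
    obtain ⟨r, hr⟩ : ∃ r, r = q - friction N γ *ᵥ p := ⟨_, rfl⟩
    rw [hform p q r hr]
    have h1 := mul_nonneg hβ0.le (stiffness_inv_form_nonneg ha hc q)
    have h2 := mul_nonneg hβ0.le ((mul_nonneg ha.le (hnn p)).trans (le_stiffness_form a hc p))
    have h3 := (abs_le.mp (hmul p r)).1
    have h4 : α * ((N - 2) / 2) / (2 * c) * (r ⬝ᵥ friction N γ *ᵥ r) ≤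
        L / c ^ 2 * (N : ℝ) ^ 3 * (γ * (r ⬝ᵥ r)) :=
      mul_le_mul hs (friction_form_le hγ r) (friction_form_nonneg hγ r) (by positivity)
    have hpos : 0 < (N : ℝ) ^ 3 * (p ⬝ᵥ p + r ⬝ᵥ r) := by
      refine mul_pos (by positivity) ((add_nonneg (hnn p) (hnn r)).lt_of_ne' fun h0 => hz ?_)
      have hp : p = 0 := dotProduct_self_eq_zero.mp (by linarith [hnn p, hnn r])
      have hr0 : r = 0 := dotProduct_self_eq_zero.mp (by linarith [hnn p, hnn r])
      have hq : q = 0 := by rw [hr0, hp, mulVec_zero, sub_zero] at hr; exact hr.symm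
      rw [hp, hq]
      ext (i | i) <;> rfl
    have h5 : (L / c ^ 2 * γ + 2 * L / c + 2) * ((N : ℝ) ^ 3 * (p ⬝ᵥ p + r ⬝ᵥ r)) ≤
        C₁ * ((N : ℝ) ^ 3 * (p ⬝ᵥ p + r ⬝ᵥ r)) := by
      refine mul_le_mul_of_nonneg_right ?_ hpos.le
      have h1 : 0 ≤ L * (a + 2 * c) / c ^ 2 := by positivity
      have h2 : 0 ≤ L / c ^ 2 * γ := by positivity
      have h4 : 0 ≤ 2 * L / γ := by positivity
      have h5 : 2 * L * γ / c ^ 2 = 2 * (L / c ^ 2 * γ) := by ring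
      rw [hC₁, h5]
      linarith
    have h6 : 0 ≤ L / c ^ 2 * γ * ((N : ℝ) ^ 3 * (p ⬝ᵥ p)) :=
      mul_nonneg (by positivity) (mul_nonneg (by positivity) (hnn p))
    have h7 : β * (p ⬝ᵥ p) + β * (r ⬝ᵥ r) = C₁ * ((N : ℝ) ^ 3 * (p ⬝ᵥ p + r ⬝ᵥ r)) := by
      rw [hβ]; ring
    linarith
  · obtain ⟨p, q, rfl, hz⟩ := hself z
    obtain ⟨r, hr⟩ : ∃ r, r = q - friction N γ *ᵥ p := ⟨_, rfl⟩
    rw [hform p q r hr, hz]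
    have h1 := mul_le_mul_of_nonneg_left (stiffness_inv_form_le ha hc q) hβ0.le
    have h2 := mul_le_mul_of_nonneg_left (stiffness_form_le a hc p) hβ0.le
    have h3 := (abs_le.mp (hmul p r)).2
    have h4 := mul_nonneg hs0 (friction_form_nonneg hγ r)
    have hR : r ⬝ᵥ r ≤ 2 * (q ⬝ᵥ q) + 2 * γ ^ 2 * (p ⬝ᵥ p) := by
      have h5 := hnn (q + friction N γ *ᵥ p)
      have h6 := friction_mulVec_dotProduct_self γ p
      have h7 := mul_le_mul_of_nonneg_left (friction_form_le hγ p) hγ.le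
      rw [hr]
      simp only [dotProduct_add, add_dotProduct, dotProduct_sub, sub_dotProduct] at h5 ⊢
      linarith
    have hS := hnn p
    have hQ := hnn q
    generalize r ⬝ᵥ r = R at *
    generalize p ⬝ᵥ p = S at *
    generalize q ⬝ᵥ q = Q at *
    have hR' : R ≤ (2 + 2 * γ ^ 2) * (S + Q) := by
      have : 0 ≤ γ ^ 2 * Q := by positivity
      linarith
    have h5 := mul_le_mul_of_nonneg_left hR'
      (by positivity : 0 ≤ (2 * L / c + 1 + C₁) * (N : ℝ) ^ 3)
    have h6 : 0 ≤ C₁ * (N : ℝ) ^ 3 * (Q + S / a + (a + 4 * c) * Q) +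
      (2 * L / c + 1) * (N : ℝ) ^ 3 * Q := by positivity
    have h7 : (C₁ * (1 + 1 / a + (a + 4 * c)) + (2 * L / c + 1) +
        (2 * L / c + 1 + C₁) * (2 + 2 * γ ^ 2)) * (N : ℝ) ^ 3 * (S + Q) =
        β * (S + Q / a) + β * ((a + 4 * c) * S) + (2 * L / c + 1) * (N : ℝ) ^ 3 * S +
        (2 * L / c + 1 + C₁) * (N : ℝ) ^ 3 * ((2 + 2 * γ ^ 2) * (S + Q)) +
        (C₁ * (N : ℝ) ^ 3 * (Q + S / a + (a + 4 * c) * Q) +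
          (2 * L / c + 1) * (N : ℝ) ^ 3 * Q) := by
      rw [hβ]; ring
    have h8 : (2 * L / c + 1 + C₁) * (N : ℝ) ^ 3 * R =
        (2 * L / c + 1) * (N : ℝ) ^ 3 * R + β * R := by rw [hβ]; ring
    rw [h7]
    linarith

end Lyapunov

/-! ### The noise matrix and the spectral gap -/

section Noise

variable {N : ℕ} {TL TR : ℝ}

theorem noise_posDef (hL : 0 < TL) (hR : 0 < TR) : (noise N TL TR).PosDef := by
  refine posDef_diagonal_iff.mpr ?_
  rintro (i | i) <;> simp only [Sum.elim_inl, Sum.elim_inr]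
  · split_ifs <;> positivity
  · norm_num

theorem noise_form_le (z : Fin N ⊕ Fin N → ℝ) :
    z ⬝ᵥ noise N TL TR *ᵥ z ≤ max 1 (max (2 * TL) (2 * TR)) * (z ⬝ᵥ z) := by
  simp only [noise, dotProduct, mulVec_diagonal, Finset.mul_sum]
  refine Finset.sum_le_sum fun i _ => ?_
  rw [mul_left_comm]
  refine mul_le_mul_of_nonneg_right ?_ (mul_self_nonneg _)
  rcases i with i | i <;> simp only [Sum.elim_inl, Sum.elim_inr]
  · split_ifs <;> simp
  · simp

theorem le_noise_form (z : Fin N ⊕ Fin N → ℝ) :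
    min 1 (min (2 * TL) (2 * TR)) * (z ⬝ᵥ z) ≤ z ⬝ᵥ noise N TL TR *ᵥ z := by
  simp only [noise, dotProduct, mulVec_diagonal, Finset.mul_sum]
  refine Finset.sum_le_sum fun i _ => ?_
  rw [mul_left_comm (z i)]
  refine mul_le_mul_of_nonneg_right ?_ (mul_self_nonneg _)
  rcases i with i | i <;> simp only [Sum.elim_inl, Sum.elim_inr]
  · split_ifs <;> simp
  · simp

theorem le_spectralGap {a c γ x : ℝ} (hN : 2 ≤ N)
    (h : ∀ μ ∈ spectrum ℂ ((drift N a c γ).map (algebraMap ℝ ℂ)), x ≤ μ.re) :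
    x ≤ spectralGap N a c γ := by
  have : Nonempty (Fin N ⊕ Fin N) := ⟨Sum.inl ⟨0, by omega⟩⟩
  refine le_csInf ((spectrum.nonempty_of_isAlgClosed_of_finiteDimensional ℂ _).image _) ?_
  rintro _ ⟨μ, hμ, rfl⟩
  exact h μ hμ

end Noise

end HarmonicChain

open HarmonicChain in
theorem proposition1p5 (a c γ : ℝ) (ha : 0 < a) (hc : 0 < c) (hγ : 0 < γ) :
    -- the lower bound of order `N⁻³`, with a constant that depends only on `a`, `c`, `γ`
    (∃ κ : ℝ, 0 < κ ∧ ∀ N : ℕ, 2 ≤ N →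
      κ / (N : ℝ) ^ 3 ≤ HarmonicChain.spectralGap N a c γ) ∧
    ∀ TL TR : ℝ, 0 < TL → 0 < TR →
      -- the matrix `b_N` is well defined, symmetric and positive definite
      (∀ N : ℕ, 2 ≤ N → ∃! b, HarmonicChain.SolvesLyapunov N a c γ TL TR b) ∧
      (∀ N : ℕ, 2 ≤ N → ∀ b, HarmonicChain.SolvesLyapunov N a c γ TL TR b →
        b.PosDef ∧
        -- the bound of the gap by the norm of `b_N`, at all temperatures
        min 1 (min (2 * TL) (2 * TR)) / (2 * HarmonicChain.matrixNorm b)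
          ≤ HarmonicChain.spectralGap N a c γ ∧
        -- in particular, if the least entry of `Π_N` is `1`
        (1 ≤ 2 * TL → 1 ≤ 2 * TR →
          1 / (2 * HarmonicChain.matrixNorm b) ≤ HarmonicChain.spectralGap N a c γ)) ∧
      -- `‖b_N‖ = O(N³)`
      (∃ C : ℝ, 0 < C ∧ ∀ N : ℕ, 2 ≤ N → ∀ b, HarmonicChain.SolvesLyapunov N a c γ TL TR b →
        HarmonicChain.matrixNorm b ≤ C * (N : ℝ) ^ 3) := by
  obtain ⟨C, hC, hW⟩ := exists_lyapunov_bounds ha hc hγ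
  have hstrict : ∀ N : ℕ, 2 ≤ N → ∃ W, IsStrictLyapunov W (drift N a c γ) := by
    intro N hN
    obtain ⟨W, h1, h2, -⟩ := hW N hN
    refine ⟨W, h2, fun z hz => lt_of_lt_of_le ?_ (h1 z)⟩
    simpa using dotProduct_star_self_pos_iff.mpr hz
  have hpd : ∀ TL TR : ℝ, 0 < TL → 0 < TR → ∀ N : ℕ, 2 ≤ N → ∀ b,
      SolvesLyapunov N a c γ TL TR b → b.PosDef := by
    intro TL TR hL hR N hN b hb
    obtain ⟨W, h⟩ := hstrict N hN
    exact h.posDef (noise_posDef hL hR) hb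
  have hgap : ∀ TL TR : ℝ, 0 < TL → 0 < TR → ∀ N : ℕ, 2 ≤ N → ∀ b,
      SolvesLyapunov N a c γ TL TR b →
      min 1 (min (2 * TL) (2 * TR)) / (2 * matrixNorm b) ≤ spectralGap N a c γ := by
    intro TL TR hL hR N hN b hb
    refine le_spectralGap hN fun μ hμ => ?_
    refine le_re_of_mem_spectrum (hpd TL TR hL hR N hN b hb).posSemidef (fun z => ?_)
      (by positivity) hμ
    rw [show b * drift N a c γ + (drift N a c γ)ᵀ * b = noise N TL TR from hb]
    exact le_noise_form z
  have hnorm : ∀ TL TR : ℝ, 0 < TL → 0 < TR → ∀ N : ℕ, 2 ≤ N → ∀ b,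
      SolvesLyapunov N a c γ TL TR b →
      matrixNorm b ≤ max 1 (max (2 * TL) (2 * TR)) * C * (N : ℝ) ^ 3 := by
    intro TL TR hL hR N hN b hb
    obtain ⟨W, h1, h2, h3⟩ := hW N hN
    have hm : 0 < max 1 (max (2 * TL) (2 * TR)) := lt_max_of_lt_left one_pos
    have hs : IsStrictLyapunov W (drift N a c γ) :=
      ⟨h2, fun z hz => lt_of_lt_of_le (by simpa using dotProduct_star_self_pos_iff.mpr hz) (h1 z)⟩
    refine matrixNorm_le_of_posSemidef (hpd TL TR hL hR N hN b hb).posSemidef (by positivity)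
      fun z => ?_
    refine (hs.form_le hb (t := max 1 (max (2 * TL) (2 * TR))) (fun x => ?_) z).trans ?_
    · exact (noise_form_le x).trans (mul_le_mul_of_nonneg_left (h1 x) hm.le)
    · have := mul_le_mul_of_nonneg_left (h3 z) hm.le
      linarith
  refine ⟨⟨1 / (2 * C), by positivity, fun N hN => ?_⟩, fun TL TR hL hR => ⟨fun N hN => ?_,
    fun N hN b hb => ⟨hpd TL TR hL hR N hN b hb, hgap TL TR hL hR N hN b hb, fun h1 h2 => ?_⟩,
    _, by positivity, hnorm TL TR hL hR⟩⟩
  · -- the gap does not depend on the temperatures; at `1 / 2` the noise matrix is the identity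
    have hh : (0 : ℝ) < 1 / 2 := by norm_num
    obtain ⟨W, h⟩ := hstrict N hN
    obtain ⟨b, hb, -⟩ := h.existsUnique (noise N (1 / 2) (1 / 2))
    have h1 := hgap _ _ hh hh N hN b hb
    have h2 := hnorm _ _ hh hh N hN b hb
    rw [show (2 : ℝ) * (1 / 2) = 1 by norm_num, min_self, min_self] at h1
    rw [show (2 : ℝ) * (1 / 2) = 1 by norm_num, max_self, max_self, one_mul] at h2
    have hN0 : (0 : ℝ) < N := by exact_mod_cast (by omega : 0 < N)
    have hb0 : 0 < matrixNorm b := by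
      have : Nonempty (Fin N ⊕ Fin N) := ⟨Sum.inl ⟨0, by omega⟩⟩
      have hpos := (hpd _ _ hh hh N hN b hb).dotProduct_mulVec_pos
        (x := fun _ => (1 : ℝ)) (fun h0 => one_ne_zero (congrFun h0 this.some))
      have hle := dotProduct_mulVec_le_matrixNorm b fun _ => (1 : ℝ)
      by_contra! hneg
      have h3 : (0 : ℝ) ≤ (fun _ : Fin N ⊕ Fin N => (1 : ℝ)) ⬝ᵥ fun _ => 1 :=
        Finset.sum_nonneg fun _ _ => mul_self_nonneg _
      have h4 := mul_nonpos_of_nonpos_of_nonneg hneg h3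
      simp only [star_trivial] at hpos
      linarith
    refine le_trans ?_ h1
    rw [div_div]
    exact one_div_le_one_div_of_le (by positivity) (by linarith)
  · obtain ⟨W, h⟩ := hstrict N hN
    exact h.existsUnique _
  · have h := hgap TL TR hL hR N hN b hb
    rwa [min_eq_left (le_min h1 h2)] at h
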